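/- Notation: $\langle\xi\rangle=(1+|\xi|^2)^{1/2}$ with $|\cdot|$ the Euclidean norm; $e_y(x)=e^{2\pi i y\cdot x}$; $I_{\varepsilon,x_0}=\prod_{j=1}^d(x_{0,j}-\varepsilon/2,\,x_{0,j}+\varepsilon/2)$; $\mathscr D(U)$ is the space of complex-valued smooth functions with compact support in the open set $U$. An open cone is an open set $\Gamma\subset\mathbb R^d$ with $t\xi\in\Gamma$ for all $\xi\in\Gamma$, $t>0$. For $f\in\mathscr D'(\mathbb R^d)$ and $\varphi\in\mathscr D(\mathbb R^d)$ the Fourier transform of the compactly supported distribution $f\varphi$ is the function $\widehat{f\varphi}(\xi)=\langle f\varphi,e_{-\xi}\rangle=\langle f,\varphi e_{-\xi}\rangle$, and $(f\varphi)_p=\sum_{k\in\mathbb Z^d}(f\varphi)(\cdot+k)$ is its periodization. The Fourier coefficients of a periodic distribution $G$ are $\langle G,e_{-n}\rangle$, $n\in\mathbb Z^d$, where the pairing of $G$ with a smooth periodic function $\theta$ is $\langle G,\rho\theta\rangle$ for any $\rho\in\mathscr D(\mathbb R^d)$ with $\sum_{k\in\mathbb Z^d}\rho(\cdot+k)=1$.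 For $\xi_0\neq0$, $(x_0,\xi_0)\notin WF(f)$ means that there are $\psi\in\mathscr D(\mathbb R^d)$ with $\psi\equiv1$ in a neighborhood of $x_0$ and an open cone $\Gamma\ni\xi_0$ such that for every $N\in\mathbb N$ there is $C_N>0$ with $|\widehat{f\psi}(\xi)|\le C_N\langle\xi\rangle^{-N}$ for all $\xi\in\Gamma$. Theorem 2.1. Let $f\in\mathscr D'(\mathbb R^d)$, $x_0\in\mathbb R^d$ and $\xi_0\in\mathbb R^d\setminus\{0\}$. The following conditions are equivalent: (i) there exist $\varepsilon\in(0,1)$, $\varphi\in\mathscr D(I_{\varepsilon,x_0})$ with $\varphi\equiv1$ in a neighborhood of $x_0$, and an open cone $\Gamma$ containing $\xi_0$ such that $$(\forall N\in\mathbb N)(\exists C_N>0)(\forall n\in\Gamma\cap\mathbb Z^d)\quad |\widehat{f\varphi}(n)|\le C_N\langle n\rangle^{-N};$$ (ii) $(x_0,\xi_0)\notin WF(f)$; (iii) there exist $\varepsilon$, $\varphi$ and $\Gamma$ as in (i) such that the Fourier coefficients $c_n$ of the periodization $(f\varphi)_p$ satisfy $$(\forall N\in\mathbb N)(\exists C_N>0)(\forall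 n\in\Gamma\cap\mathbb Z^d)\quad |c_n|\le C_N\langle n\rangle^{-N}.$$ Moreover, for each fixed choice of $\varepsilon,\varphi,\Gamma$ as in (i) (apart from the decay), the decay condition in (i) holds if and only if the decay condition in (iii) holds. -/

import Mathlib

open scoped Distributions ContDiff Topology

noncomputable section

namespace WaveFront

/-- `ℝ^d` with its Euclidean norm. -/
abbrev Rd (d : ℕ) : Type := EuclideanSpace ℝ (Fin d)

/-- Complex-valued test functions on `ℝ^d`. -/
abbrev Test (d : ℕ) : Type := 𝓓((⊤ : TopologicalSpace.Opens (Rd d)), ℂ)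

/-- Complex-valued distributions on `ℝ^d`, i.e. continuous linear maps `𝓓(ℝ^d, ℝ) → ℂ`;
their canonical extension to complex test functions is `pairing` below. -/
abbrev Dist (d : ℕ) : Type := 𝓓'((⊤ : TopologicalSpace.Opens (Rd d)), ℂ)

/-- The open cube `I_{η,x} = ∏_j (x_j - η/2, x_j + η/2)`. -/
def cube {d : ℕ} (η : ℝ) (x : Rd d) : Set (Rd d) :=
  {y | ∀ j, y j ∈ Set.Ioo (x j - η / 2) (x j + η / 2)}

/-- The Japanese bracket `⟨x⟩ = (1 + |x|^2)^{1/2}`. -/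
def bracket {d : ℕ} (x : Rd d) : ℝ := Real.sqrt (1 + ‖x‖ ^ 2)

/-- The exponential `e_y(x) = exp(2πi y·x)`. -/
def expo {d : ℕ} (y : Rd d) (x : Rd d) : ℂ :=
  Complex.exp (2 * Real.pi * Complex.I * ((inner ℝ y x : ℝ) : ℂ))

theorem contDiff_expo {d : ℕ} (y : Rd d) : ContDiff ℝ ∞ (expo y) := by
  unfold expo
  have h : ContDiff ℝ ∞ fun x : Rd d => ((inner ℝ y x : ℝ) : ℂ) :=
    Complex.ofRealCLM.contDiff.comp (contDiff_const.inner ℝ contDiff_id)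
  exact (contDiff_const.mul h).cexp

/-- The product of a smooth function and a test function. -/
def smoothMul {d : ℕ} (a : Rd d → ℂ) (ha : ContDiff ℝ ∞ a) (χ : Test d) : Test d where
  toFun x := a x * χ x
  contDiff' := ha.mul χ.contDiff
  hasCompactSupport' := χ.hasCompactSupport.mul_left
  tsupport_subset' := Set.subset_univ _

/-- The translate `x ↦ χ (x - h)` of a test function. -/
def translate {d : ℕ} (h : Rd d) (χ : Test d) : Test d where
  toFun x := χ (x - h)
  contDiff' := χ.contDiff.comp (contDiff_id.sub contDiff_const)
  hasCompactSupport' := by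
    simpa [sub_eq_add_neg, Function.comp_def] using
      χ.hasCompactSupport.comp_homeomorph (Homeomorph.addRight (-h))
  tsupport_subset' := Set.subset_univ _

/-- The action `⟨f, χ⟩ = ⟨f, Re χ⟩ + i ⟨f, Im χ⟩` of a distribution on a complex test function. -/
def pairing {d : ℕ} (f : Dist d) (χ : Test d) : ℂ :=
  f (TestFunction.postcompCLM Complex.reCLM χ) +
    Complex.I * f (TestFunction.postcompCLM Complex.imCLM χ)

/-- The action `⟨fφ, χ⟩ = ⟨f, φχ⟩` of the localized distribution `fφ` on test functions. -/
def localized {d : ℕ} (f : Dist d) (φ χ : Test d) : ℂ :=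
  pairing f (smoothMul φ φ.contDiff χ)

/-- The Fourier transform of the compactly supported distribution `fφ`:
`ξ ↦ ⟨fφ, e_{-ξ}⟩ = ⟨f, φ e_{-ξ}⟩`. -/
def fourierLocalized {d : ℕ} (f : Dist d) (φ : Test d) (ξ : Rd d) : ℂ :=
  pairing f (smoothMul (expo (-ξ)) (contDiff_expo (-ξ)) φ)

/-- An integer vector, seen in `ℝ^d`. -/
def lattice {d : ℕ} (n : Fin d → ℤ) : Rd d := WithLp.toLp 2 fun j => (n j : ℝ)

/-- An open cone: an open set that is stable under multiplication by positive scalars. -/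
def IsOpenCone {d : ℕ} (Γ : Set (Rd d)) : Prop :=
  IsOpen Γ ∧ ∀ ξ ∈ Γ, ∀ t : ℝ, 0 < t → t • ξ ∈ Γ

/-- The wave front set: `(x, ξ)` with `ξ ≠ 0` is not in it iff there are a test function `ψ` that
equals one near `x` and an open cone containing `ξ` on which the Fourier transform of `fψ` is
rapidly decreasing. -/
def waveFrontSet {d : ℕ} (f : Dist d) : Set (Rd d × Rd d) :=
  {p | p.2 ≠ 0 ∧ ¬ ∃ (ψ : Test d) (Γ : Set (Rd d)),
    (∀ᶠ x in 𝓝 p.1, ψ x = 1) ∧ IsOpenCone Γ ∧ p.2 ∈ Γ ∧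
    ∀ N : ℕ, ∃ C : ℝ, 0 < C ∧ ∀ ξ ∈ Γ, ‖fourierLocalized f ψ ξ‖ ≤ C * (bracket ξ ^ N)⁻¹}

/-- Rapid decrease of a family `c` indexed by `ℤ^d` on the lattice points of `Γ`. -/
def RapidlyDecreasingOn {d : ℕ} (Γ : Set (Rd d)) (c : (Fin d → ℤ) → ℂ) : Prop :=
  ∀ N : ℕ, ∃ C : ℝ, 0 < C ∧ ∀ n : Fin d → ℤ, lattice n ∈ Γ →
    ‖c n‖ ≤ C * (bracket (lattice n) ^ N)⁻¹

/-- The periodization `(fφ)_p = ∑_{k ∈ ℤ^d} (fφ)(· + k)`, through its action on test functions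
`⟨(fφ)_p, χ⟩ = ∑_k ⟨fφ, χ(· - k)⟩`; only finitely many terms of the sum are non-zero. -/
def periodization {d : ℕ} (f : Dist d) (φ χ : Test d) : ℂ :=
  ∑ᶠ k : Fin d → ℤ, localized f φ (translate (lattice k) χ)

/-- A smooth function on `ℝ` that vanishes outside `[-1, 1]`, whose integer translates add up
to one. -/
def cell1 (t : ℝ) : ℝ := Real.smoothTransition (t + 1) - Real.smoothTransition t

theorem cell1_eq_zero {t : ℝ} (ht : t ∉ Set.Icc (-1 : ℝ) 1) : cell1 t = 0 := by
  unfold cell1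
  rcases lt_or_ge t (-1) with h | h
  · rw [Real.smoothTransition.zero_of_nonpos (by linarith),
      Real.smoothTransition.zero_of_nonpos (by linarith), sub_zero]
  · have h1 : 1 < t := by
      by_contra hh
      exact ht ⟨h, not_lt.mp hh⟩
    rw [Real.smoothTransition.one_of_one_le (by linarith),
      Real.smoothTransition.one_of_one_le h1.le, sub_self]

/-- The test function `x ↦ ∏_j cell1 (x_j)`, whose integer translates add up to one. -/
def cell (d : ℕ) : Test d where
  toFun x := ∏ j, (cell1 (x j) : ℂ)
  contDiff' := by
    refine contDiff_prod fun j _ => ?_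
    have hj : ContDiff ℝ ∞ fun x : Rd d => x j := (EuclideanSpace.proj (𝕜 := ℝ) j).contDiff
    have hs : ContDiff ℝ ∞ Real.smoothTransition := Real.smoothTransition.contDiff
    exact Complex.ofRealCLM.contDiff.comp
      ((hs.comp (hj.add contDiff_const)).sub (hs.comp hj))
  hasCompactSupport' := by
    refine HasCompactSupport.intro
      (K := (WithLp.toLp 2) '' (Set.univ.pi fun _ : Fin d => Set.Icc (-1 : ℝ) 1)) ?_ ?_
    · exact (isCompact_univ_pi fun _ => isCompact_Icc).image (PiLp.continuous_toLp 2 _)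
    · intro x hx
      have : ∃ j, x j ∉ Set.Icc (-1 : ℝ) 1 := by
        by_contra! h
        exact hx ⟨x.ofLp, fun j _ => h j, rfl⟩
      obtain ⟨j, hj⟩ := this
      exact Finset.prod_eq_zero (Finset.mem_univ j) (by rw [cell1_eq_zero hj]; simp)
  tsupport_subset' := Set.subset_univ _

theorem sum_cell1 (t : ℝ) (a b : ℤ) (hab : a ≤ b) (ha : (a:ℝ) ≤ t - 1) (hb : t + 1 ≤ b) :
    ∑ m ∈ Finset.Icc a b, cell1 (t - m) = 1 := by
  have key : ∀ b : ℤ, a ≤ b → ∑ m ∈ Finset.Icc a b, cell1 (t - m) =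
      Real.smoothTransition (t - a + 1) - Real.smoothTransition (t - b) := by
    intro b hb
    induction b, hb using Int.leInduction with
    | base => simp [cell1]
    | succ n hn ih =>
      have : Finset.Icc a (n+1) = insert (n+1) (Finset.Icc a n) := by
        ext x; simp; omega
      rw [this, Finset.sum_insert (by simp), ih, cell1]
      push_cast
      rw [show t - (n + 1 : ℝ) + 1 = t - n by ring]; ring
  rw [key b hab, Real.smoothTransition.one_of_one_le (by linarith),
    Real.smoothTransition.zero_of_nonpos (by linarith), sub_zero]

/-- The integer translates of `cell d` add up to one. -/
theorem finsum_cell {d : ℕ} (x : Rd d) : ∑ᶠ k : Fin d → ℤ, translate (lattice k) (cell d) x = 1 := by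
  set s : Finset (Fin d → ℤ) := Fintype.piFinset fun j => Finset.Icc (⌊x j⌋ - 1) (⌈x j⌉ + 1) with hs
  have hval : ∀ k : Fin d → ℤ, translate (lattice k) (cell d) x = ∏ j, (cell1 (x j - k j) : ℂ) :=
    fun k => rfl
  rw [finsum_eq_sum_of_support_subset (s := s)]
  · simp_rw [hval, hs]
    rw [← Finset.prod_univ_sum (fun j => Finset.Icc (⌊x j⌋ - 1) (⌈x j⌉ + 1)) (fun j m => (cell1 (x j - m) : ℂ))]
    refine Finset.prod_eq_one fun j _ => ?_
    have h1 := Int.floor_le (x j)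
    have h2 := Int.le_ceil (x j)
    have h3 : ⌊x j⌋ ≤ ⌈x j⌉ := Int.floor_le_ceil _
    exact_mod_cast sum_cell1 (x j) (⌊x j⌋ - 1) (⌈x j⌉ + 1) (by omega) (by push_cast; linarith) (by push_cast; linarith)
  · intro k hk
    rw [Function.mem_support, hval, Finset.prod_ne_zero_iff] at hk
    simp only [hs, Finset.mem_coe, Fintype.mem_piFinset, Finset.mem_Icc]
    intro j
    have hj : x j - k j ∈ Set.Icc (-1:ℝ) 1 := by
      by_contra h; exact hk j (Finset.mem_univ _) (by rw [cell1_eq_zero h]; simp)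
    have h1 := Int.lt_floor_add_one (x j)
    have h2 := Int.ceil_lt_add_one (x j)
    constructor
    · rw [sub_le_iff_le_add]
      have : (⌊x j⌋:ℝ) ≤ ((k j + 1 : ℤ):ℝ) := by push_cast; linarith [Int.floor_le (x j), hj.2]
      exact_mod_cast this
    · have : ((k j:ℤ):ℝ) ≤ ((⌈x j⌉ + 1 : ℤ):ℝ) := by push_cast; linarith [Int.le_ceil (x j), hj.1]
      exact_mod_cast this

/-- The `n`-th Fourier coefficient `⟨G, e_{-n}⟩` of a periodic distribution `G`. The pairing of
`G` with a smooth periodic function `θ` is `⟨G, θρ⟩`, where `ρ` is a test function with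
`∑_{k ∈ ℤ^d} ρ(· + k) = 1`; it does not depend on the choice of `ρ`, for which `cell d` is
taken. -/
def periodicCoeff {d : ℕ} (G : Test d → ℂ) (n : Fin d → ℤ) : ℂ :=
  G (smoothMul (expo (-lattice n)) (contDiff_expo (-lattice n)) (cell d))

end WaveFront

end

open WaveFront

/-!
The Fourier coefficients of the periodization `(fφ)_p` are *equal* to the values of the Fourier
transform of `fφ` at the integer points (`periodicCoeff_periodization`): `e_{-n}` is periodic, and
the translates of the partition function `cell d` add up to one, so that the finite sum defining the
pairing collapses to `⟨f, φ e_{-n}⟩`. Hence the conditions on `c_n` are those on the Fourier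
transform at the integer points, for each fixed `φ` and `Γ`.

That decay at integer points characterizes the wave front set follows, in both directions, from one
statement (`exists_cone_rapidDecay`). Let `ψ` be supported in a cube of side `L`, let `χ = χψ`, and
suppose that the Fourier transform of `fψ` decays rapidly at the points of `L⁻¹ℤ^d` in an open cone.
Then the Fourier transform of `fχ` decays rapidly at all points of a smaller open cone. For the
proof, `χ e_{-ξ}` is expanded into its Fourier series on the cube; after multiplication by `ψ` the
series converges in the space of test functions (`hasSum_pairing`), which gives
`(fχ)^(ξ) = ∑ₙ A(Lξ - n) (fψ)^(n / L)` with a rapidly decreasing `A`, the Fourier transform of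
`y ↦ χ (L y)` (`exists_hasSum_fourierLocalized`). With `m = Lξ` in the smaller cone, the terms with
`n` in the cone are controlled by the decay of `(fψ)^` and Peetre's inequality. For the other terms
`|m - n|` is at least a constant multiple of `|m|` (`IsOpenCone.exists_subcone`), so the decay of `A`
beats the polynomial growth of `(fψ)^`, which is due to the finite order of `f` on compact sets
(`exists_norm_pairing_le`).

From integer points to the wave front set one takes `L = 1`; in the other direction `L` is chosen so
large that the cube contains the support of the given cut-off, and the new cut-off `χ` is supported
in a cube of side less than one.
-/

namespace WaveFront

variable {d : ℕ}

/-! ### Distributions as linear forms on complex test functions -/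

theorem pairing_add (f : Dist d) (χ₁ χ₂ : Test d) :
    pairing f (χ₁ + χ₂) = pairing f χ₁ + pairing f χ₂ := by
  simp only [pairing, map_add]
  ring

theorem pairing_smul (f : Dist d) (c : ℂ) (χ : Test d) :
    pairing f (c • χ) = c * pairing f χ := by
  have hre : TestFunction.postcompCLM Complex.reCLM (c • χ) =
      c.re • TestFunction.postcompCLM Complex.reCLM χ -
        c.im • TestFunction.postcompCLM Complex.imCLM χ := by
    ext x
    simp
  have him : TestFunction.postcompCLM Complex.imCLM (c • χ) =
      c.re • TestFunction.postcompCLM Complex.imCLM χ +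
        c.im • TestFunction.postcompCLM Complex.reCLM χ := by
    ext x
    simp
  simp only [pairing, hre, him, map_sub, map_add, map_smul, Complex.real_smul]
  linear_combination
    (f (TestFunction.postcompCLM Complex.reCLM χ) +
      Complex.I * f (TestFunction.postcompCLM Complex.imCLM χ)) * Complex.re_add_im c -
    (c.im : ℂ) * f (TestFunction.postcompCLM Complex.imCLM χ) * Complex.I_mul_I

/-- The pairing with a distribution, as a `ℂ`-linear form on complex test functions. -/
noncomputable def pairingLM (f : Dist d) : Test d →ₗ[ℂ] ℂ where
  toFun := pairing f
  map_add' := pairing_add f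
  map_smul' := pairing_smul f

@[simp]
theorem pairingLM_apply (f : Dist d) (χ : Test d) : pairingLM f χ = pairing f χ := rfl

theorem continuous_pairing (f : Dist d) : Continuous (pairing f) := by
  unfold pairing
  fun_prop

/-- A distribution has finite order on each compact set. -/
theorem exists_norm_pairing_le (f : Dist d) {K : Set (Rd d)} (hK : IsCompact K) :
    ∃ (k : ℕ) (C : ℝ), 0 ≤ C ∧ ∀ (χ : Test d) (B : ℝ), (∀ x ∉ K, χ x = 0) → 0 ≤ B →
      (∀ i ≤ k, ∀ x, ‖iteratedFDeriv ℝ i χ x‖ ≤ B) → ‖pairing f χ‖ ≤ C * B := by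
  let Kc : TopologicalSpace.Compacts (Rd d) := ⟨K, hK⟩
  have hsub : (Kc : Set (Rd d)) ⊆ ((⊤ : TopologicalSpace.Opens (Rd d)) : Set (Rd d)) :=
    Set.subset_univ _
  let g : 𝓓_{Kc}(Rd d, ℂ) →ₗ[ℂ] ℂ :=
    (pairingLM f).comp (TestFunction.ofSupportedInCLM ℂ hsub).toLinearMap
  have hg : Continuous g :=
    (continuous_pairing f).comp (TestFunction.continuous_ofSupportedIn hsub)
  obtain ⟨s, C, -, hC⟩ := Seminorm.bound_of_continuous
    (ContDiffMapSupportedIn.withSeminorms ℂ (Rd d) ℂ ⊤ Kc) ((normSeminorm ℂ ℂ).comp g)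
    (continuous_norm.comp hg)
  refine ⟨s.sup id, C, C.2, fun χ B hχ hB hbd => ?_⟩
  let χ' : 𝓓_{Kc}(Rd d, ℂ) := ⟨χ, χ.contDiff, fun x hx => hχ x hx⟩
  refine (hC χ').trans ?_
  refine mul_le_mul_of_nonneg_left ?_ C.2
  refine Seminorm.finset_sup_apply_le hB fun i hi => ?_
  rw [ContDiffMapSupportedIn.seminorm_top_le_iff ℂ hB]
  exact fun x _ => hbd i (Finset.le_sup (f := id) hi) x

/-- A series of test functions with supports in a common compact set, all of whose derivatives
converge normally, may be paired with a distribution term by term. -/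
theorem hasSum_pairing (f : Dist d) {ι : Type*} {K : Set (Rd d)} (hK : IsCompact K)
    {χ : Test d} {u : ι → Test d} {v : ℕ → ι → ℝ} (hu : ∀ i, ∀ x ∉ K, u i x = 0)
    (hsum : ∀ x, HasSum (fun i => u i x) (χ x)) (hv : ∀ k, Summable (v k))
    (hbd : ∀ k i x, ‖iteratedFDeriv ℝ k (u i) x‖ ≤ v k i) :
    HasSum (fun i => pairing f (u i)) (pairing f χ) := by
  obtain ⟨m, C, hC, hpair⟩ := exists_norm_pairing_le f hK
  have hv0 : ∀ k i, 0 ≤ v k i := fun k i => (norm_nonneg _).trans (hbd k i 0)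
  have key : ∀ F : Finset ι, ‖∑ i ∈ F, pairing f (u i) - pairing f χ‖ ≤
      C * ∑ k ∈ Finset.range (m + 1), ∑' i : {i // i ∉ F}, v k i := by
    intro F
    -- The remainder is the tail of the series, which may be differentiated term by term.
    have hfun : ⇑(χ - ∑ i ∈ F, u i) = fun x => ∑' i : {i // i ∉ F}, u i x := by
      funext x
      have h1 := (hsum x).summable.sum_add_tsum_subtype_compl F
      rw [(hsum x).tsum_eq] at h1
      have h2 : (∑ i ∈ F, u i) x = ∑ i ∈ F, u i x := by
        simp
      rw [FunLike.coe_sub, Pi.sub_apply, h2, ← h1]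
      simp
    have h3 : ∑ i ∈ F, pairing f (u i) - pairing f χ = -pairing f (χ - ∑ i ∈ F, u i) := by
      simp only [← pairingLM_apply, map_sub, map_sum]
      ring
    rw [h3, norm_neg]
    refine hpair _ _ (fun x hx => ?_) ?_ fun k hk x => ?_
    · rw [hfun]
      simp [hu _ x hx]
    · exact Finset.sum_nonneg fun k _ => tsum_nonneg fun i => hv0 k i
    · have hsub : ∀ k, Summable fun i : {i // i ∉ F} => v k i := fun k =>
        (hv k).subtype _
      rw [hfun, iteratedFDeriv_tsum_apply (N := ⊤) (v := fun k (i : {i // i ∉ F}) => v k i)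
        (fun i => (u i).contDiff) (fun k _ => hsub k) (fun k i x _ => hbd k i x) le_top]
      refine (tsum_of_norm_bounded (hsub k).hasSum fun i => hbd k i x).trans ?_
      exact Finset.single_le_sum (f := fun k => ∑' i : {i // i ∉ F}, v k i)
        (fun k _ => tsum_nonneg fun i => hv0 k i) (Finset.mem_range.2 (by omega))
  refine tendsto_iff_norm_sub_tendsto_zero.2 (squeeze_zero (fun _ => norm_nonneg _) key ?_)
  have : Filter.Tendsto (fun F : Finset ι =>
      C * ∑ k ∈ Finset.range (m + 1), ∑' i : {i // i ∉ F}, v k i) Filter.atTop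
      (𝓝 (C * ∑ k ∈ Finset.range (m + 1), 0)) :=
    (tendsto_finsetSum _ fun k _ => tendsto_tsum_compl_atTop_zero (v k)).const_mul C
  simpa using this

/-! ### Fourier coefficients of the periodization -/

theorem lattice_apply (n : Fin d → ℤ) (j : Fin d) : lattice n j = n j := rfl

theorem inner_lattice_lattice (n k : Fin d → ℤ) :
    inner ℝ (lattice n) (lattice k) = ((∑ j, n j * k j : ℤ) : ℝ) := by
  simp [PiLp.inner_apply, lattice_apply, mul_comm]

theorem expo_neg_lattice_sub (n k : Fin d → ℤ) (x : Rd d) :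
    expo (-lattice n) (x - lattice k) = expo (-lattice n) x := by
  unfold expo
  rw [inner_sub_right, inner_neg_left (lattice n) (lattice k), inner_lattice_lattice,
    Complex.exp_eq_exp_iff_exists_int]
  exact ⟨∑ j, n j * k j, by push_cast; ring⟩

theorem finite_setOf_norm_lattice_le (R : ℝ) : {k : Fin d → ℤ | ‖lattice k‖ ≤ R}.Finite := by
  refine (Set.Finite.pi' fun _ : Fin d => Set.finite_Icc (-⌈R⌉) ⌈R⌉).subset fun k hk j => ?_
  have h : |(k j : ℝ)| ≤ ⌈R⌉ := by
    have := (PiLp.norm_apply_le (lattice k) j).trans (hk.trans (Int.le_ceil R))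
    simpa [lattice_apply] using this
  rw [abs_le] at h
  exact ⟨by exact_mod_cast h.1, by exact_mod_cast h.2⟩

/-- The Fourier coefficients of the periodization of `fφ` are the values of the Fourier transform
of `fφ` at the integer points, since the integer translates of `cell d` add up to one and `e_{-n}`
is periodic. -/
theorem periodicCoeff_periodization (f : Dist d) (φ : Test d) (n : Fin d → ℤ) :
    periodicCoeff (periodization f φ) n = fourierLocalized f φ (lattice n) := by
  set θ : Test d :=
    smoothMul (expo (-lattice n)) (contDiff_expo (-lattice n)) (cell d) with hθ
  set T : (Fin d → ℤ) → Test d := fun k => smoothMul φ φ.contDiff (translate (lattice k) θ) with hT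
  have hTx : ∀ k x, T k x =
      φ x * expo (-lattice n) x * translate (lattice k) (cell d) x := fun k x => by
    change φ x * (expo (-lattice n) (x - lattice k) * cell d (x - lattice k)) = _
    rw [expo_neg_lattice_sub, mul_assoc]
    rfl
  have hfin : (Function.support T).Finite := by
    obtain ⟨R₁, h₁⟩ := φ.hasCompactSupport.isBounded.exists_norm_le
    obtain ⟨R₂, h₂⟩ := (cell d).hasCompactSupport.isBounded.exists_norm_le
    refine (finite_setOf_norm_lattice_le (R₁ + R₂)).subset fun k hk => ?_
    obtain ⟨x, hx⟩ : ∃ x, T k x ≠ 0 := by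
      by_contra! h
      exact hk (TestFunction.ext h)
    rw [hTx] at hx
    have hx₁ : ‖x‖ ≤ R₁ := h₁ x (subset_tsupport _ fun h => hx (by simp [h]))
    have hx₂ : ‖x - lattice k‖ ≤ R₂ :=
      h₂ _ (subset_tsupport _ fun h => hx (mul_eq_zero_of_right _ h))
    have : ‖lattice k‖ ≤ ‖x‖ + ‖x - lattice k‖ := by
      simpa using norm_sub_le x (x - lattice k)
    exact this.trans (add_le_add hx₁ hx₂)
  have h1 : periodicCoeff (periodization f φ) n = ∑ᶠ k, pairingLM f (T k) := rfl
  rw [h1, ← map_finsum (pairingLM f) hfin, pairingLM_apply, fourierLocalized]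
  congr 1
  ext x
  have h2 : (∑ᶠ k, T k) x = ∑ᶠ k, T k x := by
    rw [finsum_eq_sum_of_support_subset T (s := hfin.toFinset) (by simp),
      finsum_eq_sum_of_support_subset (fun k => T k x) (s := hfin.toFinset)
        (fun k hk => by
          simp only [Set.Finite.coe_toFinset, Function.mem_support]
          rintro h
          exact hk (by simp [h]))]
    simp
  rw [h2]
  simp_rw [hTx]
  rw [← mul_finsum, finsum_cell, mul_one, mul_comm]
  rfl

/-! ### The Japanese bracket, lattice sums and cones -/

theorem bracket_sq (x : Rd d) : bracket x ^ 2 = 1 + ‖x‖ ^ 2 :=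
  Real.sq_sqrt (by positivity)

theorem one_le_bracket (x : Rd d) : 1 ≤ bracket x :=
  Real.one_le_sqrt.2 (by nlinarith [sq_nonneg ‖x‖])

theorem bracket_pos (x : Rd d) : 0 < bracket x := zero_lt_one.trans_le (one_le_bracket x)

theorem norm_le_bracket (x : Rd d) : ‖x‖ ≤ bracket x :=
  Real.le_sqrt_of_sq_le (by linarith)

theorem bracket_le_one_add_norm (x : Rd d) : bracket x ≤ 1 + ‖x‖ :=
  Real.sqrt_le_iff.2 ⟨by positivity, by nlinarith [norm_nonneg x]⟩

theorem bracket_neg (x : Rd d) : bracket (-x) = bracket x := by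
  rw [bracket, norm_neg, bracket]

theorem bracket_smul_le {c : ℝ} (hc : 0 ≤ c) (x : Rd d) :
    bracket (c • x) ≤ (1 + c) * bracket x := by
  refine Real.sqrt_le_iff.2 ⟨by have := bracket_pos x; positivity, ?_⟩
  rw [mul_pow, bracket_sq, norm_smul, Real.norm_of_nonneg hc]
  nlinarith [mul_nonneg hc (sq_nonneg ‖x‖), sq_nonneg ‖x‖]

/-- Peetre's inequality. -/
theorem bracket_le_mul_bracket_sub (x y : Rd d) : bracket x ≤ 2 * bracket y * bracket (x - y) := by
  refine Real.sqrt_le_iff.2 ⟨by have := bracket_pos y; have := bracket_pos (x - y); positivity, ?_⟩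
  rw [mul_pow, mul_pow, bracket_sq, bracket_sq]
  have h : ‖x‖ ≤ ‖y‖ + ‖x - y‖ := by simpa using norm_add_le y (x - y)
  nlinarith [norm_nonneg x, norm_nonneg y, norm_nonneg (x - y), sq_nonneg (‖y‖ - ‖x - y‖),
    mul_nonneg (sq_nonneg ‖y‖) (sq_nonneg ‖x - y‖), mul_self_le_mul_self (norm_nonneg x) h]

theorem mul_bracket_le {c : ℝ} (hc : 0 ≤ c) (hc1 : c ≤ 1) {x y : Rd d} (h : c * ‖x‖ ≤ ‖y‖) :
    c * bracket x ≤ bracket y := by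
  refine Real.le_sqrt_of_sq_le ?_
  rw [mul_pow, bracket_sq]
  nlinarith [mul_self_le_mul_self (by positivity) h]

theorem inv_pow_le_of_le_mul {x t z : ℝ} (hx : 0 < x) (hz : 0 < z) (h : x ≤ t * z) (N : ℕ) :
    (z ^ N)⁻¹ ≤ t ^ N * (x ^ N)⁻¹ := by
  rw [← div_eq_mul_inv, le_div_iff₀ (by positivity), inv_mul_le_iff₀ (by positivity), ← mul_pow,
    mul_comm z]
  gcongr

theorem summable_bracket_pow_inv :
    Summable fun n : Fin d → ℤ => (bracket (lattice n) ^ (d + 1))⁻¹ := by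
  let b := (EuclideanSpace.basisFun (Fin d) ℝ).toBasis
  let L := Submodule.span ℤ (Set.range b)
  have hmem : ∀ n : Fin d → ℤ, lattice n ∈ L := fun n => by
    have : lattice n = ∑ j, n j • b j := by
      ext i
      simp [b, lattice, Finset.sum_apply, Pi.single_apply]
    rw [this]
    exact L.sum_mem fun j _ => L.smul_mem _ (Submodule.subset_span ⟨j, rfl⟩)
  have hinj : Function.Injective fun n : Fin d → ℤ => (⟨lattice n, hmem n⟩ : L) := fun m n h => by
    funext j
    have := congrArg (fun x : L => (x : Rd d) j) h
    simpa [lattice] using this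
  have hrank : Module.finrank ℤ L = d := by
    rw [ZLattice.rank ℝ L]
    simp
  have hs := (ZLattice.summable_norm_pow_inv L (d + 1) (by omega)).comp_injective hinj
  refine Summable.of_norm_bounded_eventually hs ?_
  filter_upwards [(Set.finite_singleton (0 : Fin d → ℤ)).compl_mem_cofinite] with n hn
  have hpos : 0 < ‖lattice n‖ := by
    refine norm_pos_iff.2 fun h => hn ?_
    ext j
    simpa [lattice] using congrArg (fun x : Rd d => x j) h
  have := bracket_pos (lattice n)
  rw [Real.norm_of_nonneg (by positivity)]
  simp only [Function.comp_apply, Submodule.coe_norm, inv_pow]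
  gcongr
  exact norm_le_bracket _

/-- Around each nonzero vector of an open cone there is a smaller open cone that is
well separated, relative to the size of its elements, from the complement of the larger one. -/
theorem IsOpenCone.exists_subcone {Γ : Set (Rd d)} (hΓ : IsOpenCone Γ) {ξ₀ : Rd d}
    (hξ₀ : ξ₀ ∈ Γ) :
    ∃ (Γ' : Set (Rd d)) (c : ℝ), IsOpenCone Γ' ∧ ξ₀ ∈ Γ' ∧ 0 < c ∧ c ≤ 1 ∧
      ∀ ξ ∈ Γ', ∀ η ∉ Γ, c * ‖ξ‖ ≤ ‖ξ - η‖ := by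
  obtain ⟨r, hr, hball⟩ := Metric.isOpen_iff.1 hΓ.1 ξ₀ hξ₀
  refine ⟨⋃ t : Set.Ioi (0 : ℝ), (fun ξ : Rd d => (t : ℝ) • ξ) ⁻¹' Metric.ball ξ₀ (r / 2),
    r / 2 / (‖ξ₀‖ + r / 2), ⟨isOpen_iUnion fun t =>
      Metric.isOpen_ball.preimage (continuous_const_smul _), ?_⟩, ?_, by positivity, ?_, ?_⟩
  · rintro ξ hξ s hs
    obtain ⟨⟨t, ht⟩, h⟩ := Set.mem_iUnion.1 hξ
    refine Set.mem_iUnion.2 ⟨⟨t / s, div_pos ht hs⟩, ?_⟩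
    simpa [smul_smul, div_mul_cancel₀ _ hs.ne'] using h
  · exact Set.mem_iUnion.2 ⟨⟨1, zero_lt_one' ℝ⟩, by simpa using hr⟩
  · exact (div_le_one (by positivity)).2 (by linarith [norm_nonneg ξ₀])
  · intro ξ hξ η hη
    obtain ⟨⟨t, ht⟩, h⟩ := Set.mem_iUnion.1 hξ
    replace ht : 0 < t := ht
    have h1 : ‖t • ξ - ξ₀‖ < r / 2 := by simpa [dist_eq_norm] using h
    have h2 : r ≤ ‖t • η - ξ₀‖ := by
      by_contra! hlt
      refine hη ?_
      have := hΓ.2 _ (hball (by simpa [dist_eq_norm] using hlt)) t⁻¹ (by positivity)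
      rwa [smul_smul, inv_mul_cancel₀ ht.ne', one_smul] at this
    have h3 : ‖t • η - ξ₀‖ ≤ ‖t • ξ - ξ₀‖ + t * ‖ξ - η‖ := by
      have := norm_sub_le (t • ξ - ξ₀) (t • (ξ - η))
      rw [norm_smul, Real.norm_of_nonneg ht.le] at this
      rwa [show t • ξ - ξ₀ - t • (ξ - η) = t • η - ξ₀ by module] at this
    have h4 : t * ‖ξ‖ ≤ ‖ξ₀‖ + r / 2 := by
      have := norm_add_le ξ₀ (t • ξ - ξ₀)
      rw [add_sub_cancel, norm_smul, Real.norm_of_nonneg ht.le] at this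
      linarith
    rw [div_mul_eq_mul_div, div_le_iff₀ (by positivity)]
    refine le_of_mul_le_mul_left ?_ ht
    nlinarith [norm_nonneg ξ₀, norm_nonneg (ξ - η)]

/-! ### Growth of Fourier transforms of localized distributions -/

theorem norm_iteratedFDeriv_expo_le (y x : Rd d) (i : ℕ) :
    ‖iteratedFDeriv ℝ i (expo y) x‖ ≤ (2 * Real.pi) ^ i * ‖y‖ ^ i := by
  set g : ℝ → ℂ := fun t => Complex.exp ((2 * Real.pi * Complex.I) * (t : ℂ)) with hg
  have hgd : ContDiff ℝ ∞ g := (contDiff_const.mul Complex.ofRealCLM.contDiff).cexp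
  have hgn : ∀ k t, ‖iteratedFDeriv ℝ k g t‖ = (2 * Real.pi) ^ k := fun k t => by
    have hder : ∀ k, iteratedDeriv k g = fun t => (2 * Real.pi * Complex.I) ^ k * g t := by
      intro k
      induction k with
      | zero => simp
      | succ k ih =>
        rw [iteratedDeriv_succ, ih]
        funext t
        have h1 : HasDerivAt g (g t * (2 * Real.pi * Complex.I)) t := by
          have := ((Complex.ofRealCLM.hasDerivAt (x := t)).const_mul
            (2 * Real.pi * Complex.I)).cexp
          simpa [hg] using this
        rw [(h1.const_mul _).deriv, pow_succ]
        ring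
    have hn : ‖g t‖ = 1 := by
      rw [hg, Complex.norm_exp]
      simp
    rw [norm_iteratedFDeriv_eq_norm_iteratedDeriv, hder, norm_mul, norm_pow, hn]
    simp [abs_of_pos Real.pi_pos]
  have hcomp : expo y = g ∘ innerSL ℝ y := rfl
  rw [hcomp, (innerSL ℝ y).iteratedFDeriv_comp_right hgd x (mod_cast le_top)]
  refine (ContinuousMultilinearMap.norm_compContinuousLinearMap_le _ _).trans ?_
  simp [hgn, mul_pow]

/-- The derivatives of `φ e_y` grow at most polynomially in `y`. -/
theorem exists_norm_iteratedFDeriv_smoothMul_expo_le (φ : Test d) (i : ℕ) :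
    ∃ C : ℝ, 0 ≤ C ∧ ∀ y x : Rd d,
      ‖iteratedFDeriv ℝ i (smoothMul (expo y) (contDiff_expo y) φ) x‖ ≤ C * bracket y ^ i := by
  have hφ : ∀ j : ℕ, ∃ C : ℝ, ∀ x, ‖iteratedFDeriv ℝ j φ x‖ ≤ C := fun j =>
    (φ.contDiff.continuous_iteratedFDeriv (mod_cast le_top)).bounded_above_of_compact_support
      (φ.hasCompactSupport.iteratedFDeriv j)
  choose A hA using hφ
  have hA0 : ∀ j, 0 ≤ A j := fun j => (norm_nonneg _).trans (hA j 0)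
  refine ⟨∑ j ∈ Finset.range (i + 1), (i.choose j) * (2 * Real.pi) ^ j * A (i - j),
    Finset.sum_nonneg fun j _ => mul_nonneg (by positivity) (hA0 _), fun y x => ?_⟩
  refine (norm_iteratedFDeriv_mul_le (contDiff_expo y) φ.contDiff x (mod_cast le_top)).trans ?_
  rw [Finset.sum_mul]
  refine Finset.sum_le_sum fun j hj => ?_
  have hb : ‖y‖ ^ j ≤ bracket y ^ i :=
    (pow_le_pow_left₀ (norm_nonneg y) (norm_le_bracket y) j).trans
      (pow_le_pow_right₀ (one_le_bracket y) (Nat.lt_succ_iff.1 (Finset.mem_range.1 hj)))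
  calc (i.choose j : ℝ) * ‖iteratedFDeriv ℝ j (expo y) x‖ * ‖iteratedFDeriv ℝ (i - j) φ x‖
      ≤ i.choose j * ((2 * Real.pi) ^ j * bracket y ^ i) * A (i - j) := by
        have := bracket_pos y
        gcongr
        · exact (norm_iteratedFDeriv_expo_le y x j).trans (by gcongr)
        · exact hA _ x
    _ = i.choose j * (2 * Real.pi) ^ j * A (i - j) * bracket y ^ i := by ring

/-- The Fourier transform of a localized distribution grows at most polynomially. -/
theorem exists_norm_fourierLocalized_le (f : Dist d) (φ : Test d) :
    ∃ (k : ℕ) (C : ℝ), 0 ≤ C ∧ ∀ ξ, ‖fourierLocalized f φ ξ‖ ≤ C * bracket ξ ^ k := by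
  obtain ⟨k, C, hC, hf⟩ := exists_norm_pairing_le f φ.hasCompactSupport
  choose A hA0 hA using exists_norm_iteratedFDeriv_smoothMul_expo_le φ
  have hsum : 0 ≤ ∑ i ∈ Finset.range (k + 1), A i := Finset.sum_nonneg fun i _ => hA0 i
  refine ⟨k, C * ∑ i ∈ Finset.range (k + 1), A i, by positivity, fun ξ => ?_⟩
  rw [mul_assoc]
  have hb := bracket_pos ξ
  refine hf _ _ (fun x hx => mul_eq_zero_of_right _ (image_eq_zero_of_notMem_tsupport hx))
    (by positivity) fun i hi x => (hA i (-ξ) x).trans ?_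
  rw [bracket_neg]
  exact mul_le_mul (Finset.single_le_sum (fun j _ => hA0 j) (Finset.mem_range.2 (by omega)))
    (pow_le_pow_right₀ (one_le_bracket ξ) hi) (by positivity) hsum

/-! ### Fourier series on a cube -/

theorem lattice_neg (n : Fin d → ℤ) : lattice (-n) = -lattice n := by
  ext j
  simp [lattice]

open scoped FourierTransform in
/-- A function supported in a cube of side one is, on this cube, the sum of its Fourier
series, whose coefficients are the values of its Fourier transform at the integer points. -/
theorem hasSum_fourier_of_tsupport_subset_cube {a : Rd d} {g : Rd d → ℂ} (hg : Continuous g)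
    (hsupp : tsupport g ⊆ cube 1 a) (hcomp : HasCompactSupport g)
    (hcoef : Summable fun n : Fin d → ℤ => 𝓕 g (lattice n)) {x : Rd d} (hx : x ∈ cube 1 a) :
    HasSum (fun n : Fin d → ℤ => 𝓕 g (lattice n) * expo (lattice n) x) (g x) := by
  set b : Fin d → ℝ := fun j => a j - 1 / 2 with hb
  -- The `1`-periodic extension of `g` from the cube, as a function on the torus.
  let F₀ : UnitAddTorus (Fin d) → ℂ := fun t =>
    g (WithLp.toLp 2 fun j => (AddCircle.equivIoc 1 (b j) (t j) : ℝ))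
  have hF : ∀ y : Fin d → ℝ, F₀ (fun j => (y j : UnitAddCircle)) =
      g (WithLp.toLp 2 fun j => toIocMod one_pos (b j) (y j)) := fun y => rfl
  have hF' : ∀ y : Fin d → ℝ, (∀ j, y j ∈ Set.Ioc (b j) (b j + 1)) →
      F₀ (fun j => (y j : UnitAddCircle)) = g (WithLp.toLp 2 y) := fun y hy => by
    rw [hF]
    congr 2
    funext j
    exact (toIocMod_eq_self one_pos).2 (hy j)
  have hcube : ∀ y ∈ cube 1 a, ∀ j, y j ∈ Set.Ioc (b j) (b j + 1) := fun y hy j => by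
    have := hy j
    constructor <;> simp only [hb] <;> linarith [this.1, this.2]
  have hsum : ∀ y : Fin d → ℝ, F₀ (fun j => (y j : UnitAddCircle)) =
      ∑ᶠ k : Fin d → ℤ, g (WithLp.toLp 2 y - lattice k) := fun y => by
    rw [hF, finsum_eq_single _ fun j => toIocDiv one_pos (b j) (y j)]
    · congr 1
      ext j
      simp [lattice, toIocMod]
    · intro k hk
      by_contra hne
      refine hk (funext fun j => ?_)
      have := hcube _ (hsupp (subset_tsupport _ hne)) j
      exact (toIocDiv_eq_of_sub_zsmul_mem_Ioc one_pos (by simpa [lattice] using this)).symm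
  have hcont : Continuous F₀ := by
    -- Continuity may be tested on `ℝ^d`, where `F₀` lifts to a locally finite sum of translates.
    have hq : IsOpenQuotientMap
        (Pi.map fun (_ : Fin d) (y : ℝ) => (y : UnitAddCircle)) :=
      IsOpenQuotientMap.piMap fun _ => QuotientAddGroup.isOpenQuotientMap_mk
    rw [hq.isQuotientMap.continuous_iff]
    have : F₀ ∘ (Pi.map fun (_ : Fin d) (y : ℝ) => (y : UnitAddCircle)) =
        fun y => ∑ᶠ k : Fin d → ℤ, g (WithLp.toLp 2 y - lattice k) := funext hsum
    rw [this]
    refine continuous_finsum (fun k => by fun_prop) fun y => ?_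
    obtain ⟨R, hR⟩ := hcomp.isBounded.exists_norm_le
    refine ⟨WithLp.toLp 2 ⁻¹' Metric.ball (WithLp.toLp 2 y : Rd d) 1,
      (PiLp.continuous_toLp 2 _).continuousAt.preimage_mem_nhds
        (Metric.ball_mem_nhds _ one_pos), ?_⟩
    refine (finite_setOf_norm_lattice_le (‖(WithLp.toLp 2 y : Rd d)‖ + 1 + R)).subset ?_
    rintro k ⟨z, hz, hzy⟩
    have h1 : ‖WithLp.toLp 2 z - lattice k‖ ≤ R := hR _ (subset_tsupport _ hz)
    have h2 : ‖WithLp.toLp 2 z - (WithLp.toLp 2 y : Rd d)‖ < 1 := by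
      simpa [dist_eq_norm] using hzy
    have h3 := norm_sub_le (WithLp.toLp 2 z) (WithLp.toLp 2 z - lattice k)
    have h4 := norm_add_le (WithLp.toLp 2 z - WithLp.toLp 2 y) (WithLp.toLp 2 y : Rd d)
    rw [sub_sub_cancel] at h3
    rw [sub_add_cancel] at h4
    change ‖lattice k‖ ≤ _
    linarith
  have hexp : ∀ (n : Fin d → ℤ) (y : Fin d → ℝ),
      UnitAddTorus.mFourier n (fun j => (y j : UnitAddCircle)) =
        expo (lattice n) (WithLp.toLp 2 y) := fun n y => by
    simp only [UnitAddTorus.mFourier, ContinuousMap.coe_mk, fourier_coe_apply, expo,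
      PiLp.inner_apply, lattice_apply]
    rw [← Complex.exp_sum]
    congr 1
    simp only [RCLike.inner_apply, conj_trivial, Complex.ofReal_sum, Complex.ofReal_mul,
      Finset.mul_sum]
    exact Finset.sum_congr rfl fun j _ => by push_cast; ring
  have hco : ∀ n, UnitAddTorus.mFourierCoeff F₀ n = 𝓕 g (lattice n) := fun n => by
    have hmeas : MeasurableSet {y : Fin d → ℝ | ∀ i, y i ∈ Set.Ioc (b i) (b i + 1)} :=
      MeasurableSet.univ_pi' fun _ => measurableSet_Ioc
    rw [UnitAddTorus.mFourierCoeff_eq_integral F₀ n b, Real.fourier_eq',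
      ← (PiLp.volume_preserving_toLp (Fin d)).integral_comp
        (MeasurableEquiv.toLp 2 (Fin d → ℝ)).measurableEmbedding,
      MeasureTheory.setIntegral_congr_fun (g := fun y : Fin d → ℝ =>
        expo (lattice (-n)) (WithLp.toLp 2 y) * g (WithLp.toLp 2 y)) hmeas
        fun y hy => by simp only [hexp, hF' y hy, smul_eq_mul]]
    rw [MeasureTheory.setIntegral_eq_integral_of_forall_compl_eq_zero]
    · refine MeasureTheory.integral_congr_ae (Filter.Eventually.of_forall fun y => ?_)
      simp only [expo, lattice_neg, inner_neg_left, smul_eq_mul]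
      rw [real_inner_comm]
      congr 2
      push_cast
      ring
    · intro y hy
      refine mul_eq_zero_of_right _ (image_eq_zero_of_notMem_tsupport fun h => hy ?_)
      exact hcube _ (hsupp h)
  have hsm : Summable (UnitAddTorus.mFourierCoeff (⟨F₀, hcont⟩ : C(UnitAddTorus (Fin d), ℂ))) := by
    simpa [funext hco] using hcoef
  have := UnitAddTorus.hasSum_mFourier_series_apply_of_summable hsm
    (fun j => (x j : UnitAddCircle))
  simpa [hco, hexp, hF' x (hcube x hx)] using this

open scoped FourierTransform in
/-- Expansion of `χ e_{-ξ}` into a Fourier series on a cube of side `L` containing the support of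
`χ`. The coefficients are the values at `Lξ - n` of a single rapidly decreasing function, namely the
Fourier transform of `y ↦ χ (L y)`. -/
theorem exists_hasSum_expo_mul (χ : Test d) {L : ℝ} (hL : 0 < L) {x₀ : Rd d}
    (hχ : tsupport χ ⊆ cube L x₀) :
    ∃ A : Rd d → ℂ, (∀ N : ℕ, ∃ C : ℝ, 0 ≤ C ∧ ∀ w, ‖A w‖ ≤ C * (bracket w ^ N)⁻¹) ∧
      ∀ ξ, ∀ x ∈ cube L x₀, HasSum
        (fun n : Fin d → ℤ => A (L • ξ - lattice n) * expo (-(L⁻¹ • lattice n)) x)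
        (expo (-ξ) x * χ x) := by
  have hcd : ContDiff ℝ ∞ fun y : Rd d => χ (L • y) :=
    χ.contDiff.comp (contDiff_const_smul L)
  have hcs : HasCompactSupport fun y : Rd d => χ (L • y) :=
    χ.hasCompactSupport.comp_homeomorph (Homeomorph.smulOfNeZero L hL.ne')
  have hdec : ∀ N : ℕ, ∃ C : ℝ, 0 ≤ C ∧
      ∀ w, ‖𝓕 (fun y : Rd d => χ (L • y)) w‖ ≤ C * (bracket w ^ N)⁻¹ := fun N => by
    set s := 𝓕 (hcs.toSchwartzMap hcd) with hs
    refine ⟨2 ^ N * ((Finset.Iic (N, 0)).sup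
      fun m : ℕ × ℕ => SchwartzMap.seminorm ℝ m.1 m.2) s, by positivity, fun w => ?_⟩
    have h := SchwartzMap.one_add_le_sup_seminorm_apply (𝕜 := ℝ) (m := (N, 0)) le_rfl le_rfl s w
    rw [norm_iteratedFDeriv_zero] at h
    have := bracket_pos w
    rw [← div_eq_mul_inv, le_div_iff₀ (by positivity), mul_comm]
    refine le_trans ?_ h
    change bracket w ^ N * ‖s w‖ ≤ _
    gcongr
    exact bracket_le_one_add_norm w
  refine ⟨𝓕 (fun y : Rd d => χ (L • y)), hdec, fun ξ x hx => ?_⟩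
  set g : Rd d → ℂ := fun y => expo (-ξ) (L • y) * χ (L • y) with hg
  have hFg : ∀ w, 𝓕 g w = 𝓕 (fun y : Rd d => χ (L • y)) (L • ξ + w) := fun w => by
    rw [Real.fourier_eq', Real.fourier_eq']
    refine MeasureTheory.integral_congr_ae (Filter.Eventually.of_forall fun y => ?_)
    simp only [hg, expo, smul_eq_mul]
    rw [← mul_assoc, ← Complex.exp_add, inner_add_right, inner_smul_right, inner_smul_right,
      inner_neg_left, real_inner_comm ξ y]
    congr 2
    push_cast
    ring
  have hgc : Continuous g :=
    ((contDiff_expo (-ξ)).continuous.comp (continuous_const_smul L)).mul hcd.continuous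
  have hsub : tsupport g ⊆ cube 1 (L⁻¹ • x₀) := fun y hy => by
    have h1 : y ∈ tsupport fun y : Rd d => χ (L • y) := tsupport_mul_subset_right hy
    have h2 : L • y ∈ cube L x₀ :=
      hχ (tsupport_comp_subset_preimage (χ : Rd d → ℂ) (continuous_const_smul L) h1)
    intro j
    have h3 := h2 j
    simp only [PiLp.smul_apply, smul_eq_mul, Set.mem_Ioo] at h3 ⊢
    rw [inv_mul_eq_div]
    constructor
    · rw [sub_lt_iff_lt_add, div_lt_iff₀ hL]
      linarith
    · rw [← sub_lt_iff_lt_add, lt_div_iff₀ hL]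
      linarith
  have hxc : L⁻¹ • x ∈ cube 1 (L⁻¹ • x₀) := fun j => by
    have h3 := hx j
    simp only [PiLp.smul_apply, smul_eq_mul, Set.mem_Ioo] at h3 ⊢
    rw [inv_mul_eq_div, inv_mul_eq_div]
    constructor
    · rw [sub_lt_iff_lt_add, div_lt_iff₀ hL, add_mul, div_mul_cancel₀ _ hL.ne']
      linarith
    · rw [← sub_lt_iff_lt_add, lt_div_iff₀ hL, sub_mul, div_mul_cancel₀ _ hL.ne']
      linarith
  have hcoef : Summable fun n : Fin d → ℤ => 𝓕 g (lattice n) := by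
    obtain ⟨C, hC, hdC⟩ := hdec (d + 1)
    refine Summable.of_norm_bounded ((summable_bracket_pow_inv (d := d)).mul_left
      (C * (2 * bracket (L • ξ)) ^ (d + 1))) fun n => ?_
    rw [hFg, mul_assoc]
    refine (hdC _).trans (mul_le_mul_of_nonneg_left ?_ hC)
    refine inv_pow_le_of_le_mul (bracket_pos _) (bracket_pos _) ?_ _
    have := bracket_le_mul_bracket_sub (lattice n) (-(L • ξ))
    rwa [bracket_neg, sub_neg_eq_add, add_comm (lattice n)] at this
  have hsum := hasSum_fourier_of_tsupport_subset_cube hgc hsub hcs.mul_left hcoef hxc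
  rw [← (Equiv.neg (Fin d → ℤ)).hasSum_iff] at hsum
  convert hsum using 1
  · funext n
    simp only [Function.comp_apply, Equiv.neg_apply, lattice_neg, hFg, ← sub_eq_add_neg, expo,
      inner_neg_left, inner_smul_left, inner_smul_right, conj_trivial, mul_neg]
  · simp [hg, smul_smul, hL.ne']

/-! ### Localizing further preserves decay on a smaller cone -/

/-- If `χ = χψ`, then the Fourier transform of `fχ` is the convolution of the Fourier transform of
`fψ`, restricted to the lattice `L⁻¹ℤ^d`, with a rapidly decreasing function. -/
theorem exists_hasSum_fourierLocalized (f : Dist d) {χ ψ : Test d} {L : ℝ} (hL : 0 < L)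
    {x₀ : Rd d} (hψ : tsupport ψ ⊆ cube L x₀) (hχψ : ∀ x, χ x * ψ x = χ x) :
    ∃ A : Rd d → ℂ, (∀ N : ℕ, ∃ C : ℝ, 0 ≤ C ∧ ∀ w, ‖A w‖ ≤ C * (bracket w ^ N)⁻¹) ∧
      ∀ ξ, HasSum (fun n : Fin d → ℤ =>
        A (L • ξ - lattice n) * fourierLocalized f ψ (L⁻¹ • lattice n))
        (fourierLocalized f χ ξ) := by
  have hsupp : tsupport χ ⊆ tsupport ψ := closure_mono fun x hx h => hx (by
    rw [← hχψ x, h, mul_zero])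
  obtain ⟨A, hA, hsum⟩ := exists_hasSum_expo_mul χ hL (hsupp.trans hψ)
  refine ⟨A, hA, fun ξ => ?_⟩
  set m := L • ξ with hm
  choose D hD0 hD using exists_norm_iteratedFDeriv_smoothMul_expo_le ψ
  let e : (Fin d → ℤ) → Test d := fun n =>
    smoothMul (expo (-(L⁻¹ • lattice n))) (contDiff_expo _) ψ
  have key := hasSum_pairing f ψ.hasCompactSupport
    (χ := smoothMul (expo (-ξ)) (contDiff_expo (-ξ)) χ)
    (u := fun n => A (m - lattice n) • e n)
    (v := fun k n => ‖A (m - lattice n)‖ * (D k * bracket (-(L⁻¹ • lattice n)) ^ k))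
    (fun n x hx => ?_) (fun x => ?_) (fun k => ?_) fun k n x => ?_
  · simp only [pairing_smul] at key
    exact key
  · change A (m - lattice n) * (expo (-(L⁻¹ • lattice n)) x * ψ x) = 0
    rw [image_eq_zero_of_notMem_tsupport hx, mul_zero, mul_zero]
  · change HasSum (fun n => A (m - lattice n) * (expo (-(L⁻¹ • lattice n)) x * ψ x))
      (expo (-ξ) x * χ x)
    by_cases hx : x ∈ cube L x₀
    · have := (hsum ξ x hx).mul_right (ψ x)
      rw [mul_assoc, hχψ] at this
      simpa only [mul_assoc] using this
    · have h0 : ψ x = 0 := image_eq_zero_of_notMem_tsupport fun h => hx (hψ h)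
      have h1 : χ x = 0 := by rw [← hχψ, h0, mul_zero]
      simp [h0, h1]
  · obtain ⟨C, hC, hdC⟩ := hA (k + (d + 1))
    refine Summable.of_nonneg_of_le (fun n => ?_) (fun n => ?_)
      ((summable_bracket_pow_inv (d := d)).mul_left
        (C * (2 * bracket m) ^ (k + (d + 1)) * (D k * (1 + L⁻¹) ^ k)))
    · have := bracket_pos (-(L⁻¹ • lattice n))
      have := hD0 k
      positivity
    · have hb := bracket_pos (lattice n)
      have := bracket_pos m
      have h1 : ‖A (m - lattice n)‖ ≤
          C * ((2 * bracket m) ^ (k + (d + 1)) * (bracket (lattice n) ^ (k + (d + 1)))⁻¹) := by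
        refine (hdC _).trans (mul_le_mul_of_nonneg_left ?_ hC)
        refine inv_pow_le_of_le_mul hb (bracket_pos _) ?_ _
        rw [← bracket_neg (m - lattice n), neg_sub]
        exact bracket_le_mul_bracket_sub (lattice n) m
      have h2 : bracket (-(L⁻¹ • lattice n)) ^ k ≤ (1 + L⁻¹) ^ k * bracket (lattice n) ^ k := by
        rw [bracket_neg, ← mul_pow]
        exact pow_le_pow_left₀ (bracket_pos _).le (bracket_smul_le (by positivity) _) k
      calc _ ≤ C * ((2 * bracket m) ^ (k + (d + 1)) * (bracket (lattice n) ^ (k + (d + 1)))⁻¹) *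
            (D k * ((1 + L⁻¹) ^ k * bracket (lattice n) ^ k)) := by
            have := hD0 k
            have := bracket_pos (-(L⁻¹ • lattice n))
            gcongr
        _ = _ := by
            rw [pow_add (bracket (lattice n))]
            field_simp
  · have : ⇑(A (m - lattice n) • e n) = A (m - lattice n) • ⇑(e n) := rfl
    rw [this, iteratedFDeriv_const_smul_apply ((e n).contDiff.of_le (mod_cast le_top)).contDiffAt,
      norm_smul]
    gcongr
    exact hD k _ x

/-- If the Fourier transform of `fψ` is rapidly decreasing on the lattice points `n / L` of an open
cone, where `L` is so large that a cube of side `L` contains the support of `ψ`, and if `χ = χψ`,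
then the Fourier transform of `fχ` is rapidly decreasing on a smaller open cone. -/
theorem exists_cone_rapidDecay (f : Dist d) {χ ψ : Test d} {L : ℝ} (hL : 0 < L)
    {x₀ : Rd d} (hψ : tsupport ψ ⊆ cube L x₀) (hχψ : ∀ x, χ x * ψ x = χ x)
    {Γ : Set (Rd d)} (hΓ : IsOpenCone Γ) {ξ₀ : Rd d} (hξ₀ : ξ₀ ∈ Γ)
    (hdec : RapidlyDecreasingOn Γ fun n => fourierLocalized f ψ (L⁻¹ • lattice n)) :
    ∃ Γ' : Set (Rd d), IsOpenCone Γ' ∧ ξ₀ ∈ Γ' ∧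
      ∀ N : ℕ, ∃ C : ℝ, 0 < C ∧ ∀ ξ ∈ Γ', ‖fourierLocalized f χ ξ‖ ≤ C * (bracket ξ ^ N)⁻¹ := by
  obtain ⟨Γ', c, hΓ', hξ₀', hc, hc1, hsep⟩ := hΓ.exists_subcone hξ₀
  obtain ⟨A, hA, hsum⟩ := exists_hasSum_fourierLocalized f hL hψ hχψ
  obtain ⟨k, G, hG, hgrow⟩ := exists_norm_fourierLocalized_le f ψ
  refine ⟨Γ', hΓ', hξ₀', fun N => ?_⟩
  obtain ⟨D, hD, hdecD⟩ := hdec (N + (d + 1))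
  obtain ⟨A₁, hA₁, hdA₁⟩ := hA N
  -- Outside `Γ` the decay of `A` has to beat the growth of the Fourier transform of `fψ` as well;
  -- the factor two comes from `⟨n⟩ ≲ ⟨m - n⟩²`.
  obtain ⟨A₂, hA₂, hdA₂⟩ := hA (N + 2 * (k + (d + 1)))
  set B₁ := A₁ * D * 2 ^ N with hB₁
  set B₂ := A₂ * (G * (1 + L⁻¹) ^ k) * (c⁻¹ ^ N * (2 * c⁻¹) ^ (k + (d + 1))) with hB₂
  have hB₁0 : 0 ≤ B₁ := by positivity
  have hB₂0 : 0 ≤ B₂ := by positivity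
  set S := ∑' n : Fin d → ℤ, (bracket (lattice n) ^ (d + 1))⁻¹ with hS
  have hS0 : 0 ≤ S := tsum_nonneg fun n => by have := bracket_pos (lattice n); positivity
  refine ⟨(B₁ + B₂) * S * (1 + L⁻¹) ^ N + 1, by positivity, fun ξ hξ => ?_⟩
  set m := L • ξ with hm
  have hmΓ : m ∈ Γ' := hΓ'.2 ξ hξ L hL
  have hX := bracket_pos m
  have hbound : ∀ n : Fin d → ℤ,
      ‖A (m - lattice n) * fourierLocalized f ψ (L⁻¹ • lattice n)‖ ≤
        (B₁ + B₂) * (bracket m ^ N)⁻¹ * (bracket (lattice n) ^ (d + 1))⁻¹ := by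
    intro n
    have hY := bracket_pos (lattice n)
    have hZ := bracket_pos (m - lattice n)
    have hPeetre := bracket_le_mul_bracket_sub m (lattice n)
    rw [norm_mul]
    by_cases hn : lattice n ∈ Γ
    · have h1 : ‖A (m - lattice n)‖ ≤
          A₁ * ((2 * bracket (lattice n)) ^ N * (bracket m ^ N)⁻¹) :=
        (hdA₁ _).trans (mul_le_mul_of_nonneg_left (inv_pow_le_of_le_mul hX hZ hPeetre N) hA₁)
      calc _ ≤ A₁ * ((2 * bracket (lattice n)) ^ N * (bracket m ^ N)⁻¹) *
            (D * (bracket (lattice n) ^ (N + (d + 1)))⁻¹) := by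
            gcongr
            exact hdecD n hn
        _ = B₁ * (bracket m ^ N)⁻¹ * (bracket (lattice n) ^ (d + 1))⁻¹ := by
            rw [hB₁, pow_add, mul_pow]
            field_simp
        _ ≤ _ := by
            gcongr
            linarith
    · have hcm : bracket m ≤ c⁻¹ * bracket (m - lattice n) := by
        rw [← div_eq_inv_mul, le_div_iff₀ hc, mul_comm]
        exact mul_bracket_le hc.le hc1 (hsep m hmΓ _ hn)
      have hnm : bracket (lattice n) ≤ 2 * c⁻¹ * bracket (m - lattice n) ^ 2 := by
        have := bracket_le_mul_bracket_sub (lattice n) m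
        rw [← bracket_neg (lattice n - m), neg_sub] at this
        calc _ ≤ _ := this
          _ ≤ 2 * (c⁻¹ * bracket (m - lattice n)) * bracket (m - lattice n) := by gcongr
          _ = _ := by ring
      have h1 : ‖A (m - lattice n)‖ ≤ A₂ * ((c⁻¹ ^ N * (bracket m ^ N)⁻¹) *
          ((2 * c⁻¹) ^ (k + (d + 1)) * (bracket (lattice n) ^ (k + (d + 1)))⁻¹)) := by
        refine (hdA₂ _).trans (mul_le_mul_of_nonneg_left ?_ hA₂)
        rw [pow_add, mul_inv, pow_mul]
        gcongr
        · exact inv_pow_le_of_le_mul hX hZ hcm N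
        · exact inv_pow_le_of_le_mul hY (by positivity) hnm _
      have h2 : ‖fourierLocalized f ψ (L⁻¹ • lattice n)‖ ≤
          G * ((1 + L⁻¹) ^ k * bracket (lattice n) ^ k) := by
        refine (hgrow _).trans (mul_le_mul_of_nonneg_left ?_ hG)
        rw [← mul_pow]
        exact pow_le_pow_left₀ (bracket_pos _).le (bracket_smul_le (by positivity) _) k
      calc _ ≤ A₂ * ((c⁻¹ ^ N * (bracket m ^ N)⁻¹) *
            ((2 * c⁻¹) ^ (k + (d + 1)) * (bracket (lattice n) ^ (k + (d + 1)))⁻¹)) *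
            (G * ((1 + L⁻¹) ^ k * bracket (lattice n) ^ k)) := by gcongr
        _ = B₂ * (bracket m ^ N)⁻¹ * (bracket (lattice n) ^ (d + 1))⁻¹ := by
            rw [hB₂, pow_add (bracket (lattice n))]
            field_simp
        _ ≤ _ := by
            gcongr
            linarith
  rw [← (hsum ξ).tsum_eq]
  refine (tsum_of_norm_bounded
    ((summable_bracket_pow_inv (d := d)).hasSum.mul_left _) hbound).trans ?_
  have hξm : bracket ξ ≤ (1 + L⁻¹) * bracket m := by
    have := bracket_smul_le (inv_nonneg.2 hL.le) m
    rwa [hm, smul_smul, inv_mul_cancel₀ hL.ne', one_smul] at this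
  have hW := bracket_pos ξ
  calc (B₁ + B₂) * (bracket m ^ N)⁻¹ * S = (B₁ + B₂) * S * (bracket m ^ N)⁻¹ := by ring
    _ ≤ (B₁ + B₂) * S * ((1 + L⁻¹) ^ N * (bracket ξ ^ N)⁻¹) := by
        gcongr
        exact inv_pow_le_of_le_mul hW hX hξm N
    _ = (B₁ + B₂) * S * (1 + L⁻¹) ^ N * (bracket ξ ^ N)⁻¹ := by ring
    _ ≤ _ := by
        gcongr
        linarith

/-! ### Cut-offs -/

/-- Every neighborhood of a point carries the support of a test function that equals one near the
point. -/
theorem exists_test_eventually_eq_one {x₀ : Rd d} {U : Set (Rd d)} (hU : U ∈ 𝓝 x₀) :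
    ∃ χ : Test d, (∀ᶠ x in 𝓝 x₀, χ x = 1) ∧ tsupport χ ⊆ U := by
  obtain ⟨r, hr, hball⟩ := Metric.nhds_basis_closedBall.mem_iff.1 hU
  let β : ContDiffBump x₀ := ⟨r / 2, r, by positivity, by linarith⟩
  have hcs : HasCompactSupport fun x => (β x : ℂ) :=
    β.hasCompactSupport.comp_left (g := fun t : ℝ => (t : ℂ)) Complex.ofReal_zero
  refine ⟨⟨fun x => (β x : ℂ), Complex.ofRealCLM.contDiff.comp β.contDiff, hcs,
    Set.subset_univ _⟩, ?_, ?_⟩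
  · filter_upwards [β.eventuallyEq_one] with x hx
    change (β x : ℂ) = 1
    simp [hx]
  · refine (tsupport_comp_subset (g := fun t : ℝ => (t : ℂ)) Complex.ofReal_zero β).trans ?_
    rw [β.tsupport_eq]
    exact hball

theorem cube_mem_nhds {ε : ℝ} (hε : 0 < ε) (x : Rd d) : cube ε x ∈ 𝓝 x := by
  have : cube ε x = ⋂ j, (fun y : Rd d => y j) ⁻¹' Set.Ioo (x j - ε / 2) (x j + ε / 2) := by
    ext y
    simp [cube]
  rw [this]
  refine (isOpen_iInter_of_finite fun j => isOpen_Ioo.preimage (by fun_prop)).mem_nhds ?_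
  simp [hε]

theorem cube_mono {ε δ : ℝ} (h : ε ≤ δ) (x : Rd d) : cube ε x ⊆ cube δ x := fun y hy j =>
  ⟨by linarith [(hy j).1], by linarith [(hy j).2]⟩

theorem exists_tsupport_subset_cube (ψ : Test d) (x₀ : Rd d) :
    ∃ L : ℝ, 1 ≤ L ∧ tsupport ψ ⊆ cube L x₀ := by
  obtain ⟨R, hR⟩ := ψ.hasCompactSupport.isBounded.exists_norm_le
  have hR0 : 0 ≤ |R| + ‖x₀‖ := by positivity
  refine ⟨2 * (|R| + ‖x₀‖) + 1, by linarith, fun y hy j => ?_⟩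
  have h : |y j - x₀ j| ≤ |R| + ‖x₀‖ := by
    have h1 := PiLp.norm_apply_le (y - x₀) j
    rw [PiLp.sub_apply, Real.norm_eq_abs] at h1
    exact h1.trans ((norm_sub_le _ _).trans (by gcongr; exact (hR y hy).trans (le_abs_self R)))
  rw [abs_le] at h
  constructor <;> linarith [h.1, h.2]

theorem mul_eq_self_of_tsupport_subset {χ ψ : Test d} (h : tsupport χ ⊆ {x | ψ x = 1}) (x : Rd d) :
    χ x * ψ x = χ x := by
  by_cases hx : x ∈ tsupport χ
  · rw [show ψ x = 1 from h hx, mul_one]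
  · rw [image_eq_zero_of_notMem_tsupport hx, zero_mul]

/-- Microlocal regularity is detected by the integer frequencies of a localization of `f` to a cube
of side less than one. -/
theorem notMem_waveFrontSet_iff_lattice (f : Dist d) {x₀ ξ₀ : Rd d} (hξ₀ : ξ₀ ≠ 0) :
    (x₀, ξ₀) ∉ waveFrontSet f ↔
      ∃ (ε : ℝ) (φ : Test d) (Γ : Set (Rd d)),
        0 < ε ∧ ε < 1 ∧ tsupport φ ⊆ cube ε x₀ ∧ (∀ᶠ x in 𝓝 x₀, φ x = 1) ∧
        IsOpenCone Γ ∧ ξ₀ ∈ Γ ∧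
        RapidlyDecreasingOn Γ (fun n => fourierLocalized f φ (lattice n)) := by
  simp only [waveFrontSet, Set.mem_ofPred_eq, not_and, not_not]
  constructor
  · intro h
    obtain ⟨ψ, Γ, hψ1, hΓ, hξΓ, hdec⟩ := h hξ₀
    obtain ⟨L, hL, hψL⟩ := exists_tsupport_subset_cube ψ x₀
    have hL0 : 0 < L := by linarith
    obtain ⟨φ, hφ1, hφ⟩ := exists_test_eventually_eq_one
      (Filter.inter_mem hψ1 (cube_mem_nhds (half_pos one_pos) x₀))
    obtain ⟨Γ', hΓ', hξΓ', hdec'⟩ := exists_cone_rapidDecay f hL0 hψL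
      (mul_eq_self_of_tsupport_subset (hφ.trans Set.inter_subset_left)) hΓ hξΓ fun N => by
        obtain ⟨C, hC, hdC⟩ := hdec N
        refine ⟨C * (1 + L) ^ N, by positivity, fun n hn => ?_⟩
        refine (hdC _ (hΓ.2 _ hn L⁻¹ (by positivity))).trans ?_
        rw [mul_assoc]
        refine mul_le_mul_of_nonneg_left ?_ hC.le
        refine inv_pow_le_of_le_mul (bracket_pos _) (bracket_pos _) ?_ N
        have := bracket_smul_le hL0.le (L⁻¹ • lattice n)
        rwa [smul_smul, mul_inv_cancel₀ hL0.ne', one_smul] at this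
    refine ⟨1 / 2, φ, Γ', by norm_num, by norm_num, hφ.trans Set.inter_subset_right, hφ1, hΓ',
      hξΓ', fun N => ?_⟩
    obtain ⟨C, hC, hdC⟩ := hdec' N
    exact ⟨C, hC, fun n hn => hdC _ hn⟩
  · rintro ⟨ε, φ, Γ, -, hε1, hφ, hφ1, hΓ, hξΓ, hdec⟩ -
    obtain ⟨ψ, hψ1, hψ⟩ := exists_test_eventually_eq_one hφ1
    obtain ⟨Γ', hΓ', hξΓ', hdec'⟩ := exists_cone_rapidDecay f one_pos
      (hφ.trans (cube_mono hε1.le x₀)) (mul_eq_self_of_tsupport_subset hψ) hΓ hξΓ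
      (by simpa using hdec)
    exact ⟨ψ, Γ', hψ1, hΓ', hξΓ', hdec'⟩

end WaveFront

theorem theorem2p1 (d : ℕ) (f : Dist d) (x₀ ξ₀ : Rd d) (hξ₀ : ξ₀ ≠ 0) :
    ((x₀, ξ₀) ∉ waveFrontSet f ↔
      ∃ (ε : ℝ) (φ : Test d) (Γ : Set (Rd d)),
        0 < ε ∧ ε < 1 ∧ tsupport φ ⊆ cube ε x₀ ∧ (∀ᶠ x in 𝓝 x₀, φ x = 1) ∧
        IsOpenCone Γ ∧ ξ₀ ∈ Γ ∧
        RapidlyDecreasingOn Γ (fun n => fourierLocalized f φ (lattice n))) ∧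
    ((x₀, ξ₀) ∉ waveFrontSet f ↔
      ∃ (ε : ℝ) (φ : Test d) (Γ : Set (Rd d)),
        0 < ε ∧ ε < 1 ∧ tsupport φ ⊆ cube ε x₀ ∧ (∀ᶠ x in 𝓝 x₀, φ x = 1) ∧
        IsOpenCone Γ ∧ ξ₀ ∈ Γ ∧
        RapidlyDecreasingOn Γ (periodicCoeff (periodization f φ))) ∧
    (∀ (ε : ℝ) (φ : Test d) (Γ : Set (Rd d)),
      0 < ε → ε < 1 → tsupport φ ⊆ cube ε x₀ → (∀ᶠ x in 𝓝 x₀, φ x = 1) →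
      IsOpenCone Γ → ξ₀ ∈ Γ →
        (RapidlyDecreasingOn Γ (fun n => fourierLocalized f φ (lattice n)) ↔
          RapidlyDecreasingOn Γ (periodicCoeff (periodization f φ)))) := by
  have hcoeff : ∀ φ : Test d, periodicCoeff (periodization f φ) =
      fun n => fourierLocalized f φ (lattice n) :=
    fun φ => funext (periodicCoeff_periodization f φ)
  refine ⟨notMem_waveFrontSet_iff_lattice f hξ₀, ?_, fun ε φ Γ _ _ _ _ _ _ => by rw [hcoeff]⟩
  simpa only [hcoeff] using notMem_waveFrontSet_iff_lattice f hξ₀
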